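/- Let $n\ge 0$, let $(M^{n+1},\bar g)$ be a complete smooth Riemannian manifold and let $f:M\to\mathbb R$ be smooth. Suppose that for some constant $k>0$ the Bakry–Émery Ricci tensor $\overline{\mathrm{Ric}}_f:=\overline{\mathrm{Ric}}+\overline\nabla^2 f$ satisfies $\overline{\mathrm{Ric}}_f(v,v)\ge k\,\bar g(v,v)$ for all tangent vectors $v$ of $M$. Then there is no nonempty smooth $n$-manifold $\Sigma$ without boundary together with a smooth immersion $\iota:\Sigma\to M$ such that, for the induced metric $\iota^*\bar g$ with volume element $d\sigma$, all of the following hold: 1. $(\Sigma,\iota^*\bar g)$ is complete; 2. $\Sigma$ is two-sided, i.e. there is a smooth unit normal field $\nu$ along $\iota$ defined on all of $\Sigma$; write $A(X)=\overline\nabla_X\nu$ and $H=\mathrm{tr}\,A$; 3. $\Sigma$ is $f$-minimal: $H=\langle\overline\nabla f,\nu\rangle$ on $\Sigma$; 4. $\Sigma$ is $L_f$-stable: for every compactly supported smooth function $\phi:\Sigma\to\mathbb R$, $$\int_\Sigma\Big[|\nabla\phi|^2-\big(|A|^2+\overline{\mathrm{Ric}}_f(\nu,\nu)\big)\phi^2\Big]e^{-f}\,d\sigma\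 \ge\ 0;$$ 5. $\Sigma$ has finite weighted volume: $\int_\Sigma e^{-f}\,d\sigma<\infty$. Neither $M$ nor $\Sigma$ is assumed connected, and $\Sigma$ may be compact or noncompact. -/

import Mathlib

open Bundle
open scoped Manifold ContDiff

noncomputable section

namespace WeightedManifold

section Ambient

variable {m : ℕ} {M : Type*} [TopologicalSpace M] [ChartedSpace (EuclideanSpace ℝ (Fin m)) M]

/-- The partial derivative `∂ᵢ u` at `y` of a function `u` on `ℝᵐ`. -/
def pd (i : Fin m) (u : EuclideanSpace ℝ (Fin m) → ℝ) (y : EuclideanSpace ℝ (Fin m)) : ℝ :=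
  fderiv ℝ u y (EuclideanSpace.single i 1)

/-- The coordinate vector field `∂ᵢ` of the preferred chart at `x`, at the point with
coordinates `y`. -/
def coordVec (x : M) (y : EuclideanSpace ℝ (Fin m)) (i : Fin m) :
    TangentSpace (𝓡 m) ((extChartAt (𝓡 m) x).symm y) :=
  mfderiv (𝓡 m) (𝓡 m) (extChartAt (𝓡 m) x).symm y
    (EuclideanSpace.single i 1 : EuclideanSpace ℝ (Fin m))

/-- The `i`-th component, in the preferred chart at `x`, of a vector `v` tangent at a point `z` of
the domain of that chart. -/
def comp (x : M) {z : M} (v : TangentSpace (𝓡 m) z) (i : Fin m) : ℝ :=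
  mvfderiv (𝓡 m) (extChartAt (𝓡 m) x) z v i

variable [RiemannianBundle (fun x : M ↦ TangentSpace (𝓡 m) x)]

/-- The matrix `(g_ij)` of the metric in the preferred chart at `x`, as a function of the
coordinates `y`. -/
def metricMatrix (x : M) (y : EuclideanSpace ℝ (Fin m)) : Matrix (Fin m) (Fin m) ℝ :=
  Matrix.of fun i j ↦ inner ℝ (coordVec x y i) (coordVec x y j)

/-- The Christoffel symbol `Γᵏ_ij` of the Levi-Civita connection in the preferred chart at `x`:
`Γᵏ_ij = ½ gᵏˡ (∂ᵢ g_jl + ∂ⱼ g_il - ∂ₗ g_ij)`. -/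
def christoffel (x : M) (k i j : Fin m) (y : EuclideanSpace ℝ (Fin m)) : ℝ :=
  (1 / 2 : ℝ) * ∑ l, (metricMatrix x y)⁻¹ k l *
    (pd i (fun z ↦ metricMatrix x z j l) y + pd j (fun z ↦ metricMatrix x z i l) y
      - pd l (fun z ↦ metricMatrix x z i j) y)

/-- The Ricci tensor at `x`, computed in the preferred chart at `x`:
`R_ij = ∂ₖ Γᵏ_ij - ∂ⱼ Γᵏ_ik + Γᵏ_kl Γˡ_ij - Γᵏ_jl Γˡ_ik`. -/
def ricci (x : M) (u v : TangentSpace (𝓡 m) x) : ℝ :=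
  let y := extChartAt (𝓡 m) x x
  ∑ i, ∑ j, ((∑ k, (pd k (christoffel x k i j) y - pd j (christoffel x k i k) y)) +
    ∑ k, ∑ l, (christoffel x k k l y * christoffel x l i j y
      - christoffel x k j l y * christoffel x l i k y)) * comp x u i * comp x v j

/-- The Hessian of `f` at `x`, computed in the preferred chart at `x`:
`(∇²f)_ij = ∂ᵢ∂ⱼ f - Γᵏ_ij ∂ₖ f`. -/
def hessian (f : M → ℝ) (x : M) (u v : TangentSpace (𝓡 m) x) : ℝ :=
  let y := extChartAt (𝓡 m) x x
  let fc : EuclideanSpace ℝ (Fin m) → ℝ := fun z ↦ f ((extChartAt (𝓡 m) x).symm z)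
  ∑ i, ∑ j, (pd i (pd j fc) y - ∑ k, christoffel x k i j y * pd k fc y)
    * comp x u i * comp x v j

/-- The Bakry-Émery Ricci tensor `Ric_f = Ric + ∇²f`. -/
def ricciF (f : M → ℝ) (x : M) (u v : TangentSpace (𝓡 m) x) : ℝ :=
  ricci x u v + hessian f x u v

/-- An orthonormal basis of the tangent space at `x` for the Riemannian metric. -/
def onb (x : M) :
    OrthonormalBasis (Fin (Module.finrank ℝ (TangentSpace (𝓡 m) x))) ℝ (TangentSpace (𝓡 m) x) :=
  haveI : FiniteDimensional ℝ (TangentSpace (𝓡 m) x) :=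
    inferInstanceAs (FiniteDimensional ℝ (EuclideanSpace ℝ (Fin m)))
  stdOrthonormalBasis ℝ (TangentSpace (𝓡 m) x)

/-- The Riemannian gradient `∇f = ∑ₐ df(eₐ) eₐ`. -/
def grad (f : M → ℝ) (x : M) : TangentSpace (𝓡 m) x :=
  ∑ a, mvfderiv (𝓡 m) f x (onb x a) • onb x a

/-- The Riemannian volume of the domain of the preferred chart at `x`, as a measure on `M`:
the image of `√(det g) dy` under the inverse of the chart. -/
def chartVolume [MeasurableSpace M] (x : M) : MeasureTheory.Measure M :=
  MeasureTheory.Measure.map (extChartAt (𝓡 m) x).symm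
    ((MeasureTheory.volume.restrict (extChartAt (𝓡 m) x).target).withDensity
      fun y ↦ ENNReal.ofReal (Real.sqrt (metricMatrix x y).det))

variable (m M) in
/-- The Riemannian volume measure. By the change of variables formula the measures `chartVolume x`
agree on the overlaps of the chart domains; the volume is the measure that they glue to, which is
their supremum, i.e. the least measure that dominates all of them. -/
def riemVolume [MeasurableSpace M] : MeasureTheory.Measure M :=
  ⨆ x : M, chartVolume (m := m) x

end Ambient

section Hypersurface

variable {n : ℕ}
  {M : Type*} [TopologicalSpace M] [ChartedSpace (EuclideanSpace ℝ (Fin (n + 1))) M]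
  [RiemannianBundle (fun x : M ↦ TangentSpace (𝓡 (n + 1)) x)]
  {S : Type*} [TopologicalSpace S] [ChartedSpace (EuclideanSpace ℝ (Fin n)) S]
  [RiemannianBundle (fun p : S ↦ TangentSpace (𝓡 n) p)]

/-- `ι : S → M` is a smooth immersion and the Riemannian metric of `S` is the induced metric
`ι^* g`. (The second condition makes every differential of `ι` injective.) -/
structure IsIsometricImmersion (ι : S → M) : Prop where
  contMDiff : ContMDiff (𝓡 n) (𝓡 (n + 1)) ∞ ι
  inner_mfderiv : ∀ (p : S) (u v : TangentSpace (𝓡 n) p),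
    inner ℝ (mfderiv (𝓡 n) (𝓡 (n + 1)) ι p u) (mfderiv (𝓡 n) (𝓡 (n + 1)) ι p v) = inner ℝ u v

/-- `ν` is a globally defined smooth unit normal field along `ι`; the hypersurface is two-sided
when there is one. -/
structure IsUnitNormal [IsManifold (𝓡 (n + 1)) ∞ M] (ι : S → M)
    (ν : (p : S) → TangentSpace (𝓡 (n + 1)) (ι p)) : Prop where
  contMDiff : ContMDiff (𝓡 n) (𝓡 (n + 1)).tangent ∞
    (fun p ↦ (⟨ι p, ν p⟩ : TangentBundle (𝓡 (n + 1)) M))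
  norm_eq_one : ∀ p, ‖ν p‖ = 1
  inner_eq_zero : ∀ (p : S) (u : TangentSpace (𝓡 n) p),
    inner ℝ (ν p) (mfderiv (𝓡 n) (𝓡 (n + 1)) ι p u) = 0

/-- The `k`-th component of the Levi-Civita covariant derivative `∇_u ν` along `ι`, in the
preferred chart at `ι p`: `(∇_u ν)ᵏ = u(νᵏ) + Γᵏ_ab (dι u)ᵃ νᵇ`. -/
def covDerivComp (ι : S → M) (ν : (p : S) → TangentSpace (𝓡 (n + 1)) (ι p)) (p : S)
    (u : TangentSpace (𝓡 n) p) (k : Fin (n + 1)) : ℝ :=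
  mvfderiv (𝓡 n) (fun q ↦ comp (ι p) (ν q) k) p u +
    ∑ a, ∑ b, christoffel (ι p) k a b (extChartAt (𝓡 (n + 1)) (ι p) (ι p)) *
      comp (ι p) (mfderiv (𝓡 n) (𝓡 (n + 1)) ι p u) a * comp (ι p) (ν p) b

/-- The second fundamental form `⟨A u, v⟩ = ⟨∇_u ν, dι v⟩`. -/
def secondFF (ι : S → M) (ν : (p : S) → TangentSpace (𝓡 (n + 1)) (ι p)) (p : S)
    (u v : TangentSpace (𝓡 n) p) : ℝ :=
  ∑ k, ∑ l, metricMatrix (ι p) (extChartAt (𝓡 (n + 1)) (ι p) (ι p)) k l *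
    covDerivComp ι ν p u k * comp (ι p) (mfderiv (𝓡 n) (𝓡 (n + 1)) ι p v) l

/-- The mean curvature `H = tr A`. -/
def meanCurvature (ι : S → M) (ν : (p : S) → TangentSpace (𝓡 (n + 1)) (ι p)) (p : S) : ℝ :=
  ∑ a, secondFF ι ν p (onb p a) (onb p a)

/-- The squared norm `|A|²` of the second fundamental form. -/
def normSqA (ι : S → M) (ν : (p : S) → TangentSpace (𝓡 (n + 1)) (ι p)) (p : S) : ℝ :=
  ∑ a, ∑ b, secondFF ι ν p (onb p a) (onb p b) ^ 2

/-- The hypersurface is `f`-minimal: `H = ⟨∇f, ν⟩`. -/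
def IsFMinimal (f : M → ℝ) (ι : S → M) (ν : (p : S) → TangentSpace (𝓡 (n + 1)) (ι p)) : Prop :=
  ∀ p, meanCurvature ι ν p = inner ℝ (grad (m := n + 1) f (ι p)) (ν p)

variable (n) in
/-- The weighted measure `e^{-f} dσ` of the hypersurface. -/
def weightedMeasure [MeasurableSpace S] (f : M → ℝ) (ι : S → M) : MeasureTheory.Measure S :=
  (riemVolume n S).withDensity fun p ↦ ENNReal.ofReal (Real.exp (-f (ι p)))

variable (n) in
/-- The weighted volume `∫ e^{-f} dσ` of the hypersurface. -/
def weightedVolume [MeasurableSpace S] (f : M → ℝ) (ι : S → M) : ENNReal :=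
  ∫⁻ p, ENNReal.ofReal (Real.exp (-f (ι p))) ∂(riemVolume n S)

/-- The integrand `|∇φ|² - (|A|² + Ric_f(ν,ν)) φ²` of the second variation. -/
def stabilityIntegrand (f : M → ℝ) (ι : S → M) (ν : (p : S) → TangentSpace (𝓡 (n + 1)) (ι p))
    (φ : S → ℝ) (p : S) : ℝ :=
  ‖grad (m := n) φ p‖ ^ 2 - (normSqA ι ν p + ricciF f (ι p) (ν p) (ν p)) * φ p ^ 2

/-- `∫ F dμ ≥ 0`, read as `∫ F⁻ dμ ≤ ∫ F⁺ dμ`, so that no junk value of the integral intervenes;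
see `integralNonneg_iff` for the comparison with the Bochner integral. -/
def IntegralNonneg {X : Type*} [MeasurableSpace X] (μ : MeasureTheory.Measure X) (F : X → ℝ) :
    Prop :=
  ∫⁻ x, ENNReal.ofReal (-F x) ∂μ ≤ ∫⁻ x, ENNReal.ofReal (F x) ∂μ

theorem integralNonneg_iff {X : Type*} [MeasurableSpace X] {μ : MeasureTheory.Measure X}
    {F : X → ℝ} (hF : MeasureTheory.Integrable F μ) : IntegralNonneg μ F ↔ 0 ≤ ∫ x, F x ∂μ := by
  have h1 : ∫⁻ x, ENNReal.ofReal (F x) ∂μ ≠ ⊤ := hF.lintegral_lt_top.ne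
  have h2 : ∫⁻ x, ENNReal.ofReal (-F x) ∂μ ≠ ⊤ := hF.neg.lintegral_lt_top.ne
  rw [MeasureTheory.integral_eq_lintegral_pos_part_sub_lintegral_neg_part hF, sub_nonneg,
    ENNReal.toReal_le_toReal h2 h1, IntegralNonneg]

/-- `L_f`-stability: `∫ [|∇φ|² - (|A|² + Ric_f(ν,ν)) φ²] e^{-f} dσ ≥ 0` for every compactly
supported smooth function `φ`. -/
def IsLfStable [MeasurableSpace S] (f : M → ℝ) (ι : S → M)
    (ν : (p : S) → TangentSpace (𝓡 (n + 1)) (ι p)) : Prop :=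
  ∀ φ : S → ℝ, ContMDiff (𝓡 n) 𝓘(ℝ, ℝ) ∞ φ → HasCompactSupport φ →
    IntegralNonneg (weightedMeasure n f ι) (stabilityIntegrand f ι ν φ)

end Hypersurface

end WeightedManifold

end

open WeightedManifold

/-! The potential `|A|² + Ric_f(ν,ν)` in the second variation is at least `k`. Take a compactly
supported test function with `|∇φ|² ≤ t ≤ k/8` everywhere and `φ ≥ 1/2` on a unit ball `U`. The
integrand is at most `t - k/4 ≤ -k/8` on `U` and at most `t` everywhere, so stability forces `(k/8)
μ(U) ≤ t μ(Σ)` for the weighted measure `μ`. Since `μ(Σ) < ∞`, and `μ(U) > 0` by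
`riemVolume_pos_of_isOpen`, a small `t` gives a contradiction.

Completeness of `Σ` provides the test functions (`exists_cutoff_abs_mvfderiv_le`). By a Hopf–Rinow
argument (`isCompact_closedEBall_of_interpolation`) closed balls of finite radius are compact, so
`max(0, 1 - c d(p,·))` is a `c`-Lipschitz function vanishing off a compact set. It is made smooth by
`exists_contMDiff_approx_of_lipschitz`: mollify in almost isometric charts and glue with a partition
of unity. The constant factor lost in the differential is harmless because `c` is arbitrary. -/

open scoped NNReal ENNReal Topology

/-! ### Hopf–Rinow: compactness of closed balls -/

/-- A complete locally compact extended metric space in which points can be interpolated at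
prescribed distances has compact closed balls of finite radius. -/
theorem isCompact_closedEBall_of_interpolation {X : Type*} [EMetricSpace X] [CompleteSpace X]
    [LocallyCompactSpace X]
    (hX : ∀ (x y : X) (s r : ℝ≥0∞), edist x y < s + r → ∃ z, edist x z ≤ s ∧ edist z y ≤ r)
    (p : X) (r : ℝ≥0) : IsCompact (Metric.closedEBall p r) := by
  have hmono : ∀ {a b : ℝ≥0}, a ≤ b → IsCompact (Metric.closedEBall p b) →
      IsCompact (Metric.closedEBall p a) := fun hab hb ↦
    hb.of_isClosed_subset Metric.isClosed_closedEBall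
      (Metric.closedEBall_subset_closedEBall (by exact_mod_cast hab))
  by_contra hr
  -- Continuity method: if the ball of radius `r` is not compact, the compact radii have a finite
  -- supremum `s`. Completeness shows that `s` is attained, local compactness that it can be
  -- exceeded.
  set G : Set ℝ≥0 := {a | IsCompact (Metric.closedEBall p a)} with hG
  have hbdd : BddAbove G := ⟨r, fun a ha ↦ le_of_not_ge fun h ↦ hr (hmono h ha)⟩
  have h0 : (0 : ℝ≥0) ∈ G := by simp [hG]
  set s := sSup G with hs
  have hlt : ∀ a < s, a ∈ G := fun a ha ↦ by
    obtain ⟨b, hb, hab⟩ := exists_lt_of_lt_csSup ⟨0, h0⟩ ha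
    exact hmono hab.le hb
  have hsG : s ∈ G := by
    rcases eq_or_ne s 0 with h | h
    · rwa [h]
    refine isCompact_iff_totallyBounded_isComplete.2
      ⟨EMetric.totallyBounded_iff.2 fun ε hε ↦ ?_, Metric.isClosed_closedEBall.isComplete⟩
    obtain ⟨δ, hδ0, hδ⟩ := ENNReal.lt_iff_exists_nnreal_btwn.1 hε
    have hδ0 : 0 < δ := by exact_mod_cast hδ0
    -- Since `(s - δ/4) + δ/2 > s`, each point of the `s`-ball lies within `δ/2` of the compact ball
    -- of radius `s - δ/4`. A finite `δ/2`-net of the latter is thus a `δ`-net of the former.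
    have hsub : s - δ / 4 < s := tsub_lt_self (pos_iff_ne_zero.2 h) (by positivity)
    have hc : IsCompact (Metric.closedEBall p ((s - δ / 4 : ℝ≥0) : ℝ≥0∞)) := hlt _ hsub
    obtain ⟨t, ht, htc⟩ := EMetric.totallyBounded_iff.1 hc.totallyBounded ((δ / 2 : ℝ≥0) : ℝ≥0∞)
      (by exact_mod_cast half_pos hδ0)
    refine ⟨t, ht, fun y hy ↦ ?_⟩
    have h1 : s < (s - δ / 4) + δ / 2 := by
      have : s ≤ (s - δ / 4) + δ / 4 := le_tsub_add
      refine this.trans_lt ?_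
      gcongr
      norm_num
    obtain ⟨z, hz, hzy⟩ := hX p y ((s - δ / 4 : ℝ≥0) : ℝ≥0∞) ((δ / 2 : ℝ≥0) : ℝ≥0∞) (by
      rw [Metric.mem_closedEBall'] at hy
      exact hy.trans_lt (by exact_mod_cast h1))
    have hz' := htc (Metric.mem_closedEBall'.2 hz)
    simp only [Set.mem_iUnion, Metric.mem_eball] at hz' ⊢
    obtain ⟨c, hct, hc⟩ := hz'
    refine ⟨c, hct, ?_⟩
    calc edist y c ≤ edist y z + edist z c := edist_triangle _ _ _
      _ < ((δ / 2 : ℝ≥0) : ℝ≥0∞) + ((δ / 2 : ℝ≥0) : ℝ≥0∞) := by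
        rw [edist_comm y z]
        exact ENNReal.add_lt_add_of_le_of_lt (hzy.trans_lt ENNReal.coe_lt_top).ne hzy hc
      _ = δ := by rw [← ENNReal.coe_add, add_halves]
      _ < ε := hδ
  have hsc : IsCompact (Metric.closedEBall p (s : ℝ≥0∞)) := hsG
  -- A compact neighbourhood `K` of the `s`-ball contains its `δ`-thickening. By interpolation this
  -- contains the ball of radius `s + δ/4`.
  obtain ⟨K, hK, hsK⟩ := exists_compact_superset hsc
  obtain ⟨δ, hδ, hδK⟩ := hsc.exists_thickening_subset_open isOpen_interior hsK
  lift δ to ℝ≥0 using hδ.le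
  have hδ : 0 < δ := by exact_mod_cast hδ
  have hmem : s + δ / 4 ∈ G := by
    refine hK.of_isClosed_subset Metric.isClosed_closedEBall fun y hy ↦ interior_subset (hδK ?_)
    have h1 : s + δ / 4 < s + δ / 2 := by
      gcongr
      norm_num
    obtain ⟨z, hz, hzy⟩ := hX p y (s : ℝ≥0∞) ((δ / 2 : ℝ≥0) : ℝ≥0∞) (by
      rw [Metric.mem_closedEBall'] at hy
      exact hy.trans_lt (by exact_mod_cast h1))
    rw [Metric.mem_thickening_iff_exists_edist_lt]
    refine ⟨z, Metric.mem_closedEBall'.2 hz, ?_⟩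
    rw [edist_comm, ENNReal.ofReal_coe_nnreal]
    exact hzy.trans_lt (by exact_mod_cast half_lt_self hδ)
  have := le_csSup hbdd hmem
  rw [← hs] at this
  exact absurd this (not_le.2 (lt_add_of_pos_right _ (by positivity)))

/-- In a Riemannian manifold one finds points on an almost shortest path which split it in any
prescribed proportion. -/
theorem exists_edist_le_of_edist_lt_add {E : Type*} [NormedAddCommGroup E] [NormedSpace ℝ E]
    {H : Type*} [TopologicalSpace H] (I : ModelWithCorners ℝ E H)
    {X : Type*} [EMetricSpace X] [ChartedSpace H X]
    [RiemannianBundle (fun x : X ↦ TangentSpace I x)] [IsRiemannianManifold I X] {x y : X}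
    {s r : ℝ≥0∞} (h : edist x y < s + r) : ∃ z, edist x z ≤ s ∧ edist z y ≤ r := by
  rcases le_or_gt (edist x y) s with hs | hs
  · exact ⟨y, hs, by simp⟩
  rw [IsRiemannianManifold.out (I := I)] at h
  obtain ⟨γ, h0, h1, hγ, hlen⟩ := Manifold.exists_lt_of_riemannianEDist_lt h
  have hcont : ContinuousOn (fun t ↦ edist x (γ t)) (Set.Icc 0 1) :=
    continuous_const.edist continuous_id |>.comp_continuousOn hγ.continuousOn
  -- Cut the path where its distance from `x` is exactly `s`: the first piece has length at least
  -- `s`, so less than `r` remains for the second.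
  obtain ⟨t, ht, hts⟩ : s ∈ (fun t ↦ edist x (γ t)) '' Set.Icc 0 1 := by
    refine intermediate_value_Icc zero_le_one hcont ⟨?_, ?_⟩
    · simp [h0]
    · simpa [h1] using hs.le
  refine ⟨γ t, hts.le, ?_⟩
  have e1 : s ≤ Manifold.pathELength I γ 0 t := by
    rw [← hts]
    dsimp only
    rw [IsRiemannianManifold.out (I := I)]
    exact Manifold.riemannianEDist_le_pathELength
      (hγ.mono (Set.Icc_subset_Icc_right ht.2)) h0 rfl ht.1
  have e2 : edist (γ t) y ≤ Manifold.pathELength I γ t 1 := by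
    rw [IsRiemannianManifold.out (I := I)]
    exact Manifold.riemannianEDist_le_pathELength
      (hγ.mono (Set.Icc_subset_Icc_left ht.1)) rfl h1 ht.2
  rw [← Manifold.pathELength_add ht.1 ht.2] at hlen
  have h3 : s + edist (γ t) y < s + r := (add_le_add e1 e2).trans_lt hlen
  exact (lt_of_add_lt_add_left h3).le

/-! ### Mollification in Euclidean space -/

open MeasureTheory ContinuousLinearMap in
/-- A Lipschitz function on a finite-dimensional space is uniformly approximated by smooth
functions with the same Lipschitz constant. -/
theorem LipschitzWith.exists_contDiff_approx {E : Type*} [NormedAddCommGroup E]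
    [InnerProductSpace ℝ E] [FiniteDimensional ℝ E]
    {v : E → ℝ} {C : ℝ≥0} (hv : LipschitzWith C v) {δ : ℝ} (hδ : 0 < δ) :
    ∃ w : E → ℝ, ContDiff ℝ ∞ w ∧ (∀ x, |w x - v x| ≤ δ) ∧ LipschitzWith C w := by
  borelize E
  -- Averaging over a ball of radius `ε` moves values by at most `C ε ≤ δ`; the `+ 1` covers `C =
  -- 0`.
  set ε : ℝ := δ / (C + 1) with hε
  have hε0 : 0 < ε := by positivity
  let φ : ContDiffBump (0 : E) := ⟨ε / 2, ε, half_pos hε0, half_lt_self hε0⟩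
  let w : E → ℝ := convolution (φ.normed volume) v (lsmul ℝ ℝ) volume
  have hint : ∀ x, ConvolutionExistsAt (φ.normed volume) v x (lsmul ℝ ℝ) volume := fun x ↦
    φ.hasCompactSupport_normed.convolutionExists_left _ φ.continuous_normed
      hv.continuous.locallyIntegrable x
  refine ⟨w, φ.hasCompactSupport_normed.contDiff_convolution_left _ φ.contDiff_normed
    hv.continuous.locallyIntegrable, fun x ↦ ?_, LipschitzWith.of_dist_le_mul fun x y ↦ ?_⟩
  · rw [← Real.dist_eq]
    refine φ.dist_normed_convolution_le hv.continuous.aestronglyMeasurable fun y hy ↦ ?_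
    refine (hv.dist_le_mul y x).trans ?_
    have : dist y x ≤ ε := (Metric.mem_ball.1 hy).le
    calc C * dist y x ≤ (C + 1) * ε := by gcongr; linarith
      _ = δ := by rw [hε]; field_simp
  · have hx := hint x
    have hy := hint y
    -- The convolution averages translates of `v` with nonnegative weights of total mass one, so the
    -- Lipschitz constant is kept.
    have : w x - w y = ∫ t, φ.normed volume t * (v (x - t) - v (y - t)) := by
      simp only [w, convolution_def, lsmul_apply, smul_eq_mul, mul_sub]
      rw [integral_sub]
      · simpa [ConvolutionExistsAt] using hx
      · simpa [ConvolutionExistsAt] using hy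
    rw [Real.dist_eq, this, ← Real.norm_eq_abs]
    calc ‖∫ t, φ.normed volume t * (v (x - t) - v (y - t))‖
        ≤ ∫ t, φ.normed volume t * (C * dist x y) := by
          refine norm_integral_le_of_norm_le (φ.integrable_normed.mul_const _) (.of_forall fun t ↦ ?_)
          rw [norm_mul, Real.norm_of_nonneg (φ.nonneg_normed t)]
          refine mul_le_mul_of_nonneg_left ?_ (φ.nonneg_normed t)
          have := hv.dist_le_mul (x - t) (y - t)
          rwa [dist_sub_right, dist_eq_norm] at this
      _ = C * dist x y := by rw [integral_mul_const, φ.integral_normed, one_mul]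

/-! ### Almost isometric charts -/

section Charts

variable {m : ℕ}

section Topological

variable {X : Type*} [TopologicalSpace X] [ChartedSpace (EuclideanSpace ℝ (Fin m)) X]
  [IsManifold (𝓡 m) 1 X]

/-- Continuity of the metric is expressed through the bundle trivialization, coordinate fields
through derivatives of inverse charts; this links the two. -/
theorem symmL_trivializationAt_eq_mfderiv_extChartAt_symm (x : X) {z : EuclideanSpace ℝ (Fin m)}
    (hz : z ∈ (extChartAt (𝓡 m) x).target) (u : EuclideanSpace ℝ (Fin m)) :
    (trivializationAt (EuclideanSpace ℝ (Fin m)) (TangentSpace (𝓡 m)) x).symmL ℝ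
      ((extChartAt (𝓡 m) x).symm z) u = mfderiv (𝓡 m) (𝓡 m) (extChartAt (𝓡 m) x).symm z u := by
  have hy : (extChartAt (𝓡 m) x).symm z ∈ (chartAt (EuclideanSpace ℝ (Fin m)) x).source := by
    simpa using (extChartAt (𝓡 m) x).map_target hz
  have h := congr($(TangentBundle.symmL_trivializationAt (I := 𝓡 m) hy) u)
  rw [(extChartAt (𝓡 m) x).right_inv hz] at h
  rw [h, ModelWithCorners.range_eq_univ, mfderivWithin_univ]

variable [RiemannianBundle (fun x : X ↦ TangentSpace (𝓡 m) x)]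
  [IsContinuousRiemannianBundle (EuclideanSpace ℝ (Fin m)) (fun x : X ↦ TangentSpace (𝓡 m) x)]

/-- After a linear change of coordinates, the preferred chart at `x` is almost isometric at all
points near `x`. -/
theorem exists_linearEquiv_eventually_norm_mfderiv_extChartAt_le (x : X) :
    ∃ A : EuclideanSpace ℝ (Fin m) ≃L[ℝ] EuclideanSpace ℝ (Fin m),
      (∀ᶠ y in 𝓝 x, ∀ v : TangentSpace (𝓡 m) y,
        ‖A (mvfderiv (𝓡 m) (extChartAt (𝓡 m) x) y v)‖ ≤ 2 * ‖v‖) ∧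
      ∀ᶠ z in 𝓝 (extChartAt (𝓡 m) x x), ∀ w : EuclideanSpace ℝ (Fin m),
        ‖mfderiv (𝓡 m) (𝓡 m) (extChartAt (𝓡 m) x).symm z (A.symm w)‖ ≤ 2 * ‖w‖ := by
  have : FiniteDimensional ℝ (TangentSpace (𝓡 m) x) :=
    inferInstanceAs (FiniteDimensional ℝ (EuclideanSpace ℝ (Fin m)))
  have hdim : Module.finrank ℝ (TangentSpace (𝓡 m) x) = m :=
    (finrank_euclideanSpace_fin (𝕜 := ℝ) (n := m) :)
  let B : TangentSpace (𝓡 m) x ≃ₗᵢ[ℝ] EuclideanSpace ℝ (Fin m) :=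
    ((stdOrthonormalBasis ℝ (TangentSpace (𝓡 m) x)).reindex (finCongr hdim)).repr
  let T := trivializationAt (EuclideanSpace ℝ (Fin m)) (TangentSpace (𝓡 m)) x
  have hx : x ∈ T.baseSet := FiberBundle.mem_baseSet_trivializationAt' x
  -- With this `A`, the differential at `x` of `A` after the chart is a linear isometry. Continuity
  -- of the metric then gives both bounds nearby, for any factor above `1`.
  let A : EuclideanSpace ℝ (Fin m) ≃L[ℝ] EuclideanSpace ℝ (Fin m) :=
    (T.continuousLinearEquivAt ℝ x hx).symm.trans B.toContinuousLinearEquiv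
  refine ⟨A, ?_, ?_⟩
  · filter_upwards [eventually_norm_symmL_trivializationAt_self_comp_lt (EuclideanSpace ℝ (Fin m))
      (fun x : X ↦ TangentSpace (𝓡 m) x) x one_lt_two,
      chart_source_mem_nhds (EuclideanSpace ℝ (Fin m)) x] with y h1 hy v
    have := (T.symmL ℝ x ∘L T.continuousLinearMapAt ℝ y).le_of_opNorm_le h1.le v
    refine le_trans (le_of_eq ?_) this
    rw [← B.norm_map]
    have h3 := congr($(TangentBundle.continuousLinearMapAt_trivializationAt (I := 𝓡 m) hy) v)
    rw [ContinuousLinearMap.comp_apply, h3, ← T.symm_continuousLinearEquivAt_eq hx]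
    rfl
  · have hc := (continuousAt_extChartAt_symm (I := 𝓡 m) x).eventually (p := fun y ↦
      ‖T.symmL ℝ y ∘L T.continuousLinearMapAt ℝ x‖ < 2) (by
        rw [extChartAt_to_inv]
        exact eventually_norm_symmL_trivializationAt_comp_self_lt (EuclideanSpace ℝ (Fin m))
          (fun x : X ↦ TangentSpace (𝓡 m) x) x one_lt_two)
    filter_upwards [hc, extChartAt_target_mem_nhds x] with z h2 hz w
    have := (T.symmL ℝ ((extChartAt (𝓡 m) x).symm z) ∘L
      T.continuousLinearMapAt ℝ x).le_of_opNorm_le h2.le (B.symm w)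
    rw [B.symm.norm_map] at this
    refine le_trans (le_of_eq ?_) this
    rw [← symmL_trivializationAt_eq_mfderiv_extChartAt_symm x hz,
      ContinuousLinearMap.comp_apply, ← T.coe_continuousLinearEquivAt_eq hx]
    rfl

end Topological

section Metric

variable {X : Type*} [EMetricSpace X] [ChartedSpace (EuclideanSpace ℝ (Fin m)) X]
  [IsManifold (𝓡 m) 1 X] [RiemannianBundle (fun x : X ↦ TangentSpace (𝓡 m) x)]
  [IsRiemannianManifold (𝓡 m) X]

/-- The distance of two points joined by a coordinate segment along which the inverse of a chart
has bounded derivative. -/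
theorem edist_extChartAt_symm_le (x : X)
    (A : EuclideanSpace ℝ (Fin m) ≃L[ℝ] EuclideanSpace ℝ (Fin m))
    {a b : EuclideanSpace ℝ (Fin m)} (h : ∀ z ∈ segment ℝ a b,
      A.symm z ∈ (extChartAt (𝓡 m) x).target ∧ ∀ w : EuclideanSpace ℝ (Fin m),
        ‖mfderiv (𝓡 m) (𝓡 m) (extChartAt (𝓡 m) x).symm (A.symm z) (A.symm w)‖ ≤ 2 * ‖w‖) :
    edist ((extChartAt (𝓡 m) x).symm (A.symm a)) ((extChartAt (𝓡 m) x).symm (A.symm b)) ≤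
      2 * edist a b := by
  let η : ℝ → EuclideanSpace ℝ (Fin m) := fun t ↦ A.symm (AffineMap.lineMap a b t)
  have hηd : ∀ t, HasDerivAt η (A.symm (b - a)) t := fun t ↦ by
    have h1 : HasDerivAt (fun t : ℝ ↦ AffineMap.lineMap a b t) (b - a) t :=
      AffineMap.hasDerivAt_lineMap
    exact A.symm.hasFDerivAt.comp_hasDerivAt t h1
  have hηs : ContDiff ℝ 1 η := by
    have : ContDiff ℝ 1 (fun t : ℝ ↦ AffineMap.lineMap a b t) := by
      simp only [AffineMap.lineMap_apply_module']
      fun_prop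
    exact A.symm.contDiff.comp this
  have hmem : ∀ t ∈ Set.Icc (0 : ℝ) 1, AffineMap.lineMap a b t ∈ segment ℝ a b := fun t ht ↦ by
    rw [segment_eq_image_lineMap]
    exact ⟨t, ht, rfl⟩
  have hγ : ContMDiffOn 𝓘(ℝ, ℝ) (𝓡 m) 1 ((extChartAt (𝓡 m) x).symm ∘ η) (Set.Icc 0 1) :=
    (contMDiffOn_extChartAt_symm x).comp hηs.contMDiff.contMDiffOn
      fun t ht ↦ (h _ (hmem t ht)).1
  rw [IsRiemannianManifold.out (I := 𝓡 m)]
  refine (Manifold.riemannianEDist_le_pathELength hγ (by simp [η]) (by simp [η])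
    zero_le_one).trans ?_
  rw [Manifold.pathELength_eq_lintegral_mfderiv_Icc]
  have hbd : ∀ t ∈ Set.Icc (0 : ℝ) 1,
      ‖mfderiv 𝓘(ℝ, ℝ) (𝓡 m) ((extChartAt (𝓡 m) x).symm ∘ η) t (1 : ℝ)‖ₑ ≤ 2 * edist a b := by
    intro t ht
    obtain ⟨h1, h2⟩ := h _ (hmem t ht)
    have hd : MDifferentiableAt (𝓡 m) (𝓡 m) (extChartAt (𝓡 m) x).symm (η t) :=
      ((contMDiffOn_extChartAt_symm (n := 1) x).contMDiffAt
        ((isOpen_extChartAt_target x).mem_nhds h1)).mdifferentiableAt one_ne_zero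
    have hcomp := mfderiv_comp_apply (I := 𝓘(ℝ, ℝ)) t hd
      (hηd t).hasFDerivAt.hasMFDerivAt.mdifferentiableAt (1 : ℝ)
    have hη1 : mfderiv 𝓘(ℝ, ℝ) (𝓡 m) η t (1 : ℝ) = A.symm (b - a) := by
      rw [mfderiv_eq_fderiv, (hηd t).hasFDerivAt.fderiv]
      exact one_smul ℝ (A.symm (b - a))
    rw [hcomp, hη1]
    have h3 := h2 (b - a)
    have h4 : 2 * edist a b = ENNReal.ofReal (2 * ‖b - a‖) := by
      rw [edist_comm, edist_eq_enorm_sub, ← ofReal_norm, ENNReal.ofReal_mul zero_le_two,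
        ENNReal.ofReal_ofNat]
    rw [h4, ← ofReal_norm]
    exact ENNReal.ofReal_le_ofReal h3
  calc _ ≤ ∫⁻ t in Set.Icc (0 : ℝ) 1, 2 * edist a b :=
        MeasureTheory.setLIntegral_mono' measurableSet_Icc hbd
    _ = 2 * edist a b := by simp

variable [IsContinuousRiemannianBundle (EuclideanSpace ℝ (Fin m))
  (fun x : X ↦ TangentSpace (𝓡 m) x)]

/-- Near any point there are coordinates whose differential expands lengths at most by a factor
`2`, and whose inverse expands distances at most by a factor `2`. -/
theorem exists_linearEquiv_nhds_edist_le (x : X) :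
    ∃ A : EuclideanSpace ℝ (Fin m) ≃L[ℝ] EuclideanSpace ℝ (Fin m), ∃ V ∈ 𝓝 x,
      V ⊆ (chartAt (EuclideanSpace ℝ (Fin m)) x).source ∧
      (∀ y ∈ V, ∀ v : TangentSpace (𝓡 m) y,
        ‖A (mvfderiv (𝓡 m) (extChartAt (𝓡 m) x) y v)‖ ≤ 2 * ‖v‖) ∧
      ∀ y ∈ V, ∀ y' ∈ V, edist y y' ≤
        2 * edist (A (extChartAt (𝓡 m) x y)) (A (extChartAt (𝓡 m) x y')) := by
  obtain ⟨A, h1, h2⟩ := exists_linearEquiv_eventually_norm_mfderiv_extChartAt_le (m := m) x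
  have h3 : ∀ᶠ z in 𝓝 (A (extChartAt (𝓡 m) x x)), A.symm z ∈ (extChartAt (𝓡 m) x).target ∧
      ∀ w : EuclideanSpace ℝ (Fin m),
        ‖mfderiv (𝓡 m) (𝓡 m) (extChartAt (𝓡 m) x).symm (A.symm z) (A.symm w)‖ ≤ 2 * ‖w‖ := by
    have hc : Filter.Tendsto A.symm (𝓝 (A (extChartAt (𝓡 m) x x))) (𝓝 (extChartAt (𝓡 m) x x)) := by
      simpa using A.symm.continuous.tendsto (A (extChartAt (𝓡 m) x x))
    exact hc.eventually (Filter.Eventually.and (extChartAt_target_mem_nhds x) h2)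
  -- A ball in the `A`-coordinates is convex, so the segment joining the images of two points of the
  -- neighbourhood stays where the derivative bound holds.
  obtain ⟨r, hr, hball⟩ := Metric.eventually_nhds_iff_ball.1 h3
  have h4 : ∀ᶠ y in 𝓝 x, A (extChartAt (𝓡 m) x y) ∈ Metric.ball (A (extChartAt (𝓡 m) x x)) r :=
    (A.continuous.continuousAt.comp (continuousAt_extChartAt x)).eventually
      (Metric.ball_mem_nhds _ hr)
  refine ⟨A, _, Filter.inter_mem (Filter.inter_mem h1 h4)
    (chart_source_mem_nhds (EuclideanSpace ℝ (Fin m)) x), fun y hy ↦ hy.2, fun y hy ↦ hy.1.1, ?_⟩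
  rintro y ⟨⟨-, hy⟩, hys⟩ y' ⟨⟨-, hy'⟩, hys'⟩
  have := edist_extChartAt_symm_le x A (a := A (extChartAt (𝓡 m) x y))
    (b := A (extChartAt (𝓡 m) x y'))
    fun z hz ↦ hball z ((convex_ball _ _).segment_subset hy hy' hz)
  simpa only [ContinuousLinearEquiv.symm_apply_apply, extChartAt_to_inv,
    (extChartAt (𝓡 m) x).left_inv (show y ∈ _ by simpa using hys),
    (extChartAt (𝓡 m) x).left_inv (show y' ∈ _ by simpa using hys')] using this

end Metric
end Charts

/-! ### Local smooth approximation -/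

section Approx

variable {m : ℕ}

section Topological

variable {X : Type*} [TopologicalSpace X] [ChartedSpace (EuclideanSpace ℝ (Fin m)) X]

theorem mvfderiv_eq_zero_of_notMem_tsupport {f : X → ℝ} {y : X} (hy : y ∉ tsupport f) :
    mvfderiv (𝓡 m) f y = 0 := by
  have h : f =ᶠ[𝓝 y] fun _ ↦ 0 := notMem_tsupport_iff_eventuallyEq.1 hy
  rw [mvfderiv, h.mfderiv_eq]
  exact mvfderiv_const (I := 𝓡 m) (0 : ℝ)

variable [IsManifold (𝓡 m) 1 X]

/-- The chain rule for a function of the preferred chart at `x`. -/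
theorem mvfderiv_comp_extChartAt {x y : X} (hy : y ∈ (chartAt (EuclideanSpace ℝ (Fin m)) x).source)
    {g : EuclideanSpace ℝ (Fin m) → ℝ} (hg : DifferentiableAt ℝ g (extChartAt (𝓡 m) x y))
    (v : TangentSpace (𝓡 m) y) :
    mvfderiv (𝓡 m) (g ∘ extChartAt (𝓡 m) x) y v =
      fderiv ℝ g (extChartAt (𝓡 m) x y) (mvfderiv (𝓡 m) (extChartAt (𝓡 m) x) y v) := by
  have := mvfderiv_comp_apply (I := 𝓡 m) (I' := 𝓡 m) y hg.mdifferentiableAt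
    (mdifferentiableAt_extChartAt hy) v
  rw [this, mvfderiv, mfderiv_eq_fderiv]
  rfl

variable [RiemannianBundle (fun x : X ↦ TangentSpace (𝓡 m) x)]
  [IsContinuousRiemannianBundle (EuclideanSpace ℝ (Fin m)) (fun x : X ↦ TangentSpace (𝓡 m) x)]

/-- The differential of a `C¹` function is locally bounded. -/
theorem ContMDiff.exists_eventually_abs_mvfderiv_le {f : X → ℝ}
    (hf : ContMDiff (𝓡 m) 𝓘(ℝ, ℝ) 1 f) (x : X) :
    ∃ C : ℝ, ∀ᶠ y in 𝓝 x, ∀ v : TangentSpace (𝓡 m) y, |mvfderiv (𝓡 m) f y v| ≤ C * ‖v‖ := by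
  obtain ⟨A, hA, -⟩ := exists_linearEquiv_eventually_norm_mfderiv_extChartAt_le (m := m) x
  set e := extChartAt (𝓡 m) x with he
  let g : EuclideanSpace ℝ (Fin m) → ℝ := f ∘ e.symm
  have hg : ContDiffOn ℝ 1 g e.target :=
    (hf.comp_contMDiffOn (contMDiffOn_extChartAt_symm x)).contDiffOn
  have hcont : ContinuousAt (fderiv ℝ g) (e x) :=
    (hg.continuousOn_fderiv_of_isOpen (isOpen_extChartAt_target x) le_rfl).continuousAt
      (extChartAt_target_mem_nhds x)
  have hb : ∀ᶠ y in 𝓝 x, ‖fderiv ℝ g (e y)‖ < ‖fderiv ℝ g (e x)‖ + 1 :=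
    (hcont.comp (continuousAt_extChartAt x)).norm.eventually (gt_mem_nhds (lt_add_one _))
  set K := ‖fderiv ℝ g (e x)‖ + 1
  refine ⟨K * (‖(A.symm : EuclideanSpace ℝ (Fin m) →L[ℝ] EuclideanSpace ℝ (Fin m))‖ * 2), ?_⟩
  filter_upwards [hA, hb, chart_source_mem_nhds (EuclideanSpace ℝ (Fin m)) x] with y h1 h2 hy v
  have hfg : f =ᶠ[𝓝 y] g ∘ e := by
    filter_upwards [(chartAt (EuclideanSpace ℝ (Fin m)) x).open_source.mem_nhds hy] with y' hy'
    simp only [g, Function.comp_apply, he]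
    rw [(extChartAt (𝓡 m) x).left_inv (by simpa using hy')]
  have hgd : DifferentiableAt ℝ g (e y) :=
    (hg.contDiffAt ((isOpen_extChartAt_target x).mem_nhds
      (e.map_source (by simpa [he] using hy)))).differentiableAt one_ne_zero
  have h3 : mvfderiv (𝓡 m) f y v = fderiv ℝ g (e y) (mvfderiv (𝓡 m) e y v) := by
    rw [← mvfderiv_comp_extChartAt hy hgd, mvfderiv, hfg.mfderiv_eq]
    rfl
  have h4 : ‖mvfderiv (𝓡 m) e y v‖ ≤
      ‖(A.symm : EuclideanSpace ℝ (Fin m) →L[ℝ] EuclideanSpace ℝ (Fin m))‖ * (2 * ‖v‖) := by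
    have := (A.symm : EuclideanSpace ℝ (Fin m) →L[ℝ] EuclideanSpace ℝ (Fin m)).le_opNorm_of_le
      (h1 v)
    simpa using this
  rw [h3, ← Real.norm_eq_abs]
  calc _ ≤ ‖fderiv ℝ g (e y)‖ * ‖mvfderiv (𝓡 m) e y v‖ := ContinuousLinearMap.le_opNorm _ _
    _ ≤ K * (‖(A.symm : EuclideanSpace ℝ (Fin m) →L[ℝ] EuclideanSpace ℝ (Fin m))‖ * (2 * ‖v‖)) := by
      gcongr
    _ = _ := by ring

/-- The differential of a compactly supported `C¹` function is bounded. -/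
theorem ContMDiff.exists_abs_mvfderiv_le_of_hasCompactSupport {f : X → ℝ}
    (hf : ContMDiff (𝓡 m) 𝓘(ℝ, ℝ) 1 f) (hc : HasCompactSupport f) :
    ∃ C : ℝ, 0 ≤ C ∧ ∀ y, ∀ v : TangentSpace (𝓡 m) y, |mvfderiv (𝓡 m) f y v| ≤ C * ‖v‖ := by
  obtain ⟨C, hC⟩ : ∃ C : ℝ, ∀ y ∈ tsupport f, ∀ v : TangentSpace (𝓡 m) y,
      |mvfderiv (𝓡 m) f y v| ≤ C * ‖v‖ := by
    refine hc.isCompact.induction_on (p := fun s ↦ ∃ C : ℝ, ∀ y ∈ s,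
      ∀ v : TangentSpace (𝓡 m) y, |mvfderiv (𝓡 m) f y v| ≤ C * ‖v‖) ⟨0, by simp⟩ ?_ ?_ ?_
    · rintro s t hst ⟨C, hC⟩
      exact ⟨C, fun y hy ↦ hC y (hst hy)⟩
    · rintro s t ⟨C, hC⟩ ⟨D, hD⟩
      refine ⟨max C D, fun y hy v ↦ ?_⟩
      rcases hy with hy | hy
      · exact (hC y hy v).trans (by gcongr; exact le_max_left _ _)
      · exact (hD y hy v).trans (by gcongr; exact le_max_right _ _)
    · intro x _
      obtain ⟨C, hC⟩ := hf.exists_eventually_abs_mvfderiv_le x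
      exact ⟨_, mem_nhdsWithin_of_mem_nhds hC, C, fun y hy ↦ hy⟩
  refine ⟨max C 0, le_max_right _ _, fun y v ↦ ?_⟩
  by_cases hy : y ∈ tsupport f
  · exact (hC y hy v).trans (by gcongr; exact le_max_left _ _)
  · rw [mvfderiv_eq_zero_of_notMem_tsupport hy]
    simp only [zero_apply, abs_zero]
    positivity

end Topological

section Metric

variable {X : Type*} [EMetricSpace X] [ChartedSpace (EuclideanSpace ℝ (Fin m)) X]
  [IsManifold (𝓡 m) ∞ X] [RiemannianBundle (fun x : X ↦ TangentSpace (𝓡 m) x)]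
  [IsContinuousRiemannianBundle (EuclideanSpace ℝ (Fin m)) (fun x : X ↦ TangentSpace (𝓡 m) x)]
  [IsRiemannianManifold (𝓡 m) X]

/-- Near any point, Lipschitz functions are uniformly approximated by smooth functions with
controlled differential. -/
theorem exists_nhds_smooth_approx_of_lipschitz (x : X) :
    ∃ V ∈ 𝓝 x, ∀ (L : ℝ≥0) (u : X → ℝ), LipschitzWith L u → ∀ δ : ℝ, 0 < δ →
      ∃ w : X → ℝ, ∀ y ∈ V, ContMDiffAt (𝓡 m) 𝓘(ℝ, ℝ) ∞ w y ∧ |w y - u y| ≤ δ ∧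
        ∀ v : TangentSpace (𝓡 m) y, |mvfderiv (𝓡 m) w y v| ≤ 4 * L * ‖v‖ := by
  obtain ⟨A, V, hV, hVs, h1, h2⟩ := exists_linearEquiv_nhds_edist_le (m := m) x
  refine ⟨V, hV, fun L u hu δ hδ ↦ ?_⟩
  set e := extChartAt (𝓡 m) x with he
  have hinv : ∀ y ∈ V, e.symm (e y) = y := fun y hy ↦
    e.left_inv (by simpa [he] using hVs hy)
  -- Read in coordinates, `u` is `2L`-Lipschitz on the image of `V`; it extends to all of Euclidean
  -- space and is mollified there. The differential of the chart costs a second factor `2`, whence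
  -- `4L`.
  have hlip : LipschitzOnWith (2 * L) (fun p ↦ u (e.symm (A.symm p))) ((fun y ↦ A (e y)) '' V) := by
    rintro _ ⟨y, hy, rfl⟩ _ ⟨y', hy', rfl⟩
    simp only [ContinuousLinearEquiv.symm_apply_apply, hinv y hy, hinv y' hy']
    calc edist (u y) (u y') ≤ L * edist y y' := hu y y'
      _ ≤ L * (2 * edist (A (e y)) (A (e y'))) := by gcongr; exact h2 y hy y' hy'
      _ = _ := by push_cast; ring
  obtain ⟨v₀, hv₀, heq⟩ := hlip.extend_real
  obtain ⟨w₀, hw₀, hwv, hwL⟩ := hv₀.exists_contDiff_approx hδ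
  have hg : ContDiff ℝ ∞ (w₀ ∘ A) := hw₀.comp A.contDiff
  refine ⟨(w₀ ∘ A) ∘ e, fun y hy ↦ ⟨?_, ?_, fun v ↦ ?_⟩⟩
  · exact hg.contMDiff.contMDiffAt.comp y (contMDiffAt_extChartAt' (hVs hy))
  · have h3 := heq ⟨y, hy, rfl⟩
    simp only [ContinuousLinearEquiv.symm_apply_apply, hinv y hy] at h3
    rw [h3]
    exact hwv _
  · have hwd : DifferentiableAt ℝ w₀ (A (e y)) := hw₀.differentiable (by simp) _
    rw [mvfderiv_comp_extChartAt (hVs hy) (hg.differentiable (by simp) _),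
      fderiv_comp _ hwd A.differentiableAt, A.fderiv, ← Real.norm_eq_abs]
    calc _ ≤ ‖fderiv ℝ w₀ (A (e y))‖ * ‖A (mvfderiv (𝓡 m) e y v)‖ :=
          ContinuousLinearMap.le_opNorm _ _
      _ ≤ (2 * L : ℝ≥0) * (2 * ‖v‖) := by
        gcongr
        · exact norm_fderiv_le_of_lipschitz ℝ hwL
        · exact h1 y hy v
      _ = _ := by push_cast; ring

end Metric
end Approx

/-! ### Global smooth approximation and cutoff functions -/

section Approx

variable {m : ℕ} {X : Type*} [EMetricSpace X] [ChartedSpace (EuclideanSpace ℝ (Fin m)) X]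

theorem mvfderiv_finset_sum {ι : Type*} (t : Finset ι) {f : ι → X → ℝ} {y : X}
    (hf : ∀ i ∈ t, MDifferentiableAt (𝓡 m) 𝓘(ℝ, ℝ) (f i) y) :
    MDifferentiableAt (𝓡 m) 𝓘(ℝ, ℝ) (fun x ↦ ∑ i ∈ t, f i x) y ∧
      mvfderiv (𝓡 m) (fun x ↦ ∑ i ∈ t, f i x) y = ∑ i ∈ t, mvfderiv (𝓡 m) (f i) y := by
  classical
  induction t using Finset.induction_on with
  | empty =>
    simp only [Finset.sum_empty]
    exact ⟨mdifferentiableAt_const, mvfderiv_const 0⟩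
  | insert a t ha ih =>
    obtain ⟨h1, h2⟩ := ih fun i hi ↦ hf i (Finset.mem_insert_of_mem hi)
    have h3 := hf a (Finset.mem_insert_self a t)
    simp only [Finset.sum_insert ha]
    exact ⟨h3.add h1, by rw [mvfderiv_fun_add h3 h1, h2]⟩

variable [IsManifold (𝓡 m) ∞ X] [RiemannianBundle (fun x : X ↦ TangentSpace (𝓡 m) x)]
  [IsContinuousRiemannianBundle (EuclideanSpace ℝ (Fin m)) (fun x : X ↦ TangentSpace (𝓡 m) x)]
  [IsRiemannianManifold (𝓡 m) X] [SigmaCompactSpace X]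

/-- A compactly supported Lipschitz function is uniformly approximated by compactly supported
smooth functions with controlled differential. -/
theorem exists_contMDiff_approx_of_lipschitz {K : Set X} (hK : IsCompact K) {L : ℝ≥0} {u : X → ℝ}
    (hu : LipschitzWith L u) (h0 : ∀ y ∉ interior K, u y = 0) {η : ℝ} (hη : 0 < η) :
    ∃ φ : X → ℝ, ContMDiff (𝓡 m) 𝓘(ℝ, ℝ) ∞ φ ∧ HasCompactSupport φ ∧
      (∀ y, |φ y - u y| ≤ η) ∧
      ∀ y, ∀ v : TangentSpace (𝓡 m) y, |mvfderiv (𝓡 m) φ y v| ≤ (4 * L + η) * ‖v‖ := by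
  have : LocallyCompactSpace X := ChartedSpace.locallyCompactSpace (EuclideanSpace ℝ (Fin m)) X
  choose V hV happ using exists_nhds_smooth_approx_of_lipschitz (m := m) (X := X)
  -- The compact neighbourhoods `N x` give the partition functions compact support, hence bounded
  -- differentials.
  choose N hNc hN using fun x : X ↦ exists_compact_mem_nhds x
  let U : X → Set X := fun x ↦ interior (V x ∩ N x)
  have hU : ∀ x, U x ∈ 𝓝 x := fun x ↦ interior_mem_nhds.2 (Filter.inter_mem (hV x) (hN x))
  obtain ⟨t, -, ht⟩ := hK.elim_nhds_subcover U fun x _ ↦ hU x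
  obtain ⟨f, hf⟩ := SmoothPartitionOfUnity.exists_isSubordinate (𝓡 m) hK.isClosed
    (fun i : t ↦ U i) (fun i ↦ isOpen_interior) (by
      intro y hy
      obtain ⟨i, hi, hyi⟩ := Set.mem_iUnion₂.1 (ht hy)
      exact Set.mem_iUnion.2 ⟨⟨i, hi⟩, hyi⟩)
  have hfc : ∀ i, HasCompactSupport (f i) := fun i ↦
    (hNc i).of_isClosed_subset (isClosed_tsupport _)
      ((hf i).trans (interior_subset.trans Set.inter_subset_right))
  have hfV : ∀ i, tsupport (f i) ⊆ V i := fun i ↦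
    (hf i).trans (interior_subset.trans Set.inter_subset_left)
  have hfsm : ∀ i, ContMDiff (𝓡 m) 𝓘(ℝ, ℝ) 1 (f i) := fun i ↦ (f i).contMDiff.of_le (by simp)
  choose C hC0 hC using fun i ↦ (hfsm i).exists_abs_mvfderiv_le_of_hasCompactSupport (hfc i)
  set S : ℝ := ∑ i, C i with hS
  have hS0 : 0 ≤ S := Finset.sum_nonneg fun i _ ↦ hC0 i
  -- The local error must satisfy `δ ≤ η` for the values and `δ S ≤ η` for the differential, where
  -- it multiplies those of the partition functions.
  set δ : ℝ := η / (1 + S) with hδ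
  have hδ0 : 0 < δ := by positivity
  have hδη : δ ≤ η := div_le_self hη.le (by linarith)
  have hδS : δ * S ≤ η := by
    rw [hδ, div_mul_eq_mul_div, div_le_iff₀ (by positivity)]
    nlinarith
  choose w hw using fun i : t ↦ happ i L u hu δ hδ0
  have hsum1 : ∀ y ∈ K, ∑ i, f i y = 1 := fun y hy ↦ by
    rw [← finsum_eq_sum_of_fintype]; exact f.sum_eq_one hy
  have hsumle : ∀ y, ∑ i, f i y ≤ 1 := fun y ↦ by
    rw [← finsum_eq_sum_of_fintype]; exact f.sum_le_one y
  have hz : ∀ (i : t) (y : X), y ∉ V i → f i y = 0 ∧ mvfderiv (𝓡 m) (f i) y = 0 := fun i y hy ↦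
    have h := fun h ↦ hy (hfV i h)
    ⟨image_eq_zero_of_notMem_tsupport h, mvfderiv_eq_zero_of_notMem_tsupport h⟩
  have hprod : ∀ i, ContMDiff (𝓡 m) 𝓘(ℝ, ℝ) ∞ fun y ↦ f i y * w i y := fun i ↦
    f.contMDiff_smul fun x hx ↦ (hw i x (hfV i hx)).1
  have hterm : ∀ i y (v : TangentSpace (𝓡 m) y), mvfderiv (𝓡 m) (fun y ↦ f i y * w i y) y v =
      f i y * mvfderiv (𝓡 m) (w i) y v + w i y * mvfderiv (𝓡 m) (f i) y v := by
    intro i y v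
    by_cases hy : y ∈ tsupport (f i)
    · rw [mvfderiv_fun_mul ((hfsm i).mdifferentiableAt one_ne_zero)
        ((hw i y (hfV i hy)).1.mdifferentiableAt (by simp))]
      rfl
    · have h1 : y ∉ tsupport fun y ↦ f i y * w i y := fun h ↦
        hy (closure_mono (Function.support_mul_subset_left _ _) h)
      rw [mvfderiv_eq_zero_of_notMem_tsupport h1, mvfderiv_eq_zero_of_notMem_tsupport hy,
        image_eq_zero_of_notMem_tsupport hy]
      simp
  -- On the interior of `K` the partition sums to one, so its differentials cancel; elsewhere `u =
  -- 0`. Subtracting this zero replaces `w i` by the small `w i - u` in front of the differential of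
  -- `f i`.
  have hcancel : ∀ y (v : TangentSpace (𝓡 m) y), u y * ∑ i, mvfderiv (𝓡 m) (f i) y v = 0 := by
    intro y v
    by_cases hy : y ∈ interior K
    · have h1 : (fun y ↦ ∑ i, f i y) =ᶠ[𝓝 y] fun _ ↦ 1 := by
        filter_upwards [isOpen_interior.mem_nhds hy] with z hz
        exact hsum1 z (interior_subset hz)
      have h2 : mvfderiv (𝓡 m) (fun y ↦ ∑ i, f i y) y = 0 := by
        rw [mvfderiv, h1.mfderiv_eq]
        exact mvfderiv_const (I := 𝓡 m) (1 : ℝ)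
      rw [(mvfderiv_finset_sum Finset.univ fun i _ ↦
        (hfsm i).mdifferentiableAt one_ne_zero).2] at h2
      rw [← sum_apply, h2]
      simp
    · rw [h0 y hy, zero_mul]
  refine ⟨fun y ↦ ∑ i, f i y * w i y, ?_, ?_, fun y ↦ ?_, fun y v ↦ ?_⟩
  · exact contMDiff_finsetSum fun i _ ↦ hprod i
  · refine HasCompactSupport.of_support_subset_isCompact
      (isCompact_iUnion fun i ↦ (hfc i).isCompact) fun y hy ↦ ?_
    obtain ⟨i, -, hi⟩ := Finset.exists_ne_zero_of_sum_ne_zero hy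
    exact Set.mem_iUnion.2 ⟨i, subset_tsupport _ (left_ne_zero_of_mul hi)⟩
  · have h1 : u y = ∑ i, f i y * u y := by
      rw [← Finset.sum_mul]
      by_cases hy : y ∈ K
      · rw [hsum1 y hy, one_mul]
      · rw [h0 y fun h ↦ hy (interior_subset h), mul_zero]
    rw [h1, ← Finset.sum_sub_distrib]
    calc |∑ i, (f i y * w i y - f i y * u y)| ≤ ∑ i, |f i y * w i y - f i y * u y| :=
          Finset.abs_sum_le_sum_abs _ _
      _ ≤ ∑ i, f i y * δ := Finset.sum_le_sum fun i _ ↦ by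
          rw [← mul_sub, abs_mul, abs_of_nonneg (f.nonneg i y)]
          by_cases hy : y ∈ V i
          · exact mul_le_mul_of_nonneg_left (hw i y hy).2.1 (f.nonneg i y)
          · simp [(hz i y hy).1]
      _ = (∑ i, f i y) * δ := (Finset.sum_mul ..).symm
      _ ≤ 1 * δ := by gcongr; exact hsumle y
      _ ≤ η := by rwa [one_mul]
  · rw [(mvfderiv_finset_sum Finset.univ fun i _ ↦ (hprod i).mdifferentiableAt (by simp)).2,
      sum_apply]
    have h1 : ∑ i, mvfderiv (𝓡 m) (fun y ↦ f i y * w i y) y v =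
        ∑ i, (f i y * mvfderiv (𝓡 m) (w i) y v + (w i y - u y) * mvfderiv (𝓡 m) (f i) y v) := by
      rw [← sub_zero (∑ i, mvfderiv (𝓡 m) (fun y ↦ f i y * w i y) y v), ← hcancel y v,
        Finset.mul_sum, ← Finset.sum_sub_distrib]
      refine Finset.sum_congr rfl fun i _ ↦ ?_
      rw [hterm]
      ring
    rw [h1]
    calc _ ≤ ∑ i, |f i y * mvfderiv (𝓡 m) (w i) y v + (w i y - u y) * mvfderiv (𝓡 m) (f i) y v| :=
          Finset.abs_sum_le_sum_abs _ _
      _ ≤ ∑ i, (f i y * (4 * L * ‖v‖) + δ * (C i * ‖v‖)) := Finset.sum_le_sum fun i _ ↦ by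
          by_cases hy : y ∈ V i
          · refine (abs_add_le _ _).trans ?_
            rw [abs_mul, abs_mul, abs_of_nonneg (f.nonneg i y)]
            have hfi := f.nonneg i y
            gcongr
            · exact (hw i y hy).2.2 v
            · exact (hw i y hy).2.1
            · exact hC i y v
          · have hCi := hC0 i
            simp only [(hz i y hy).1, (hz i y hy).2, zero_mul, zero_apply, mul_zero, add_zero,
              abs_zero]
            positivity
      _ = ((∑ i, f i y) * (4 * L) + δ * S) * ‖v‖ := by
          rw [Finset.sum_add_distrib, ← Finset.sum_mul, ← Finset.mul_sum, ← Finset.sum_mul, ← hS]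
          ring
      _ ≤ (1 * (4 * L) + η) * ‖v‖ := by
          gcongr
          exact hsumle y
      _ = _ := by rw [one_mul]

/-- A complete Riemannian manifold carries compactly supported smooth functions with arbitrarily
small differential which are bounded from below on a given ball. -/
theorem exists_cutoff_abs_mvfderiv_le [CompleteSpace X] (p : X) {ε : ℝ} (hε : 0 < ε) :
    ∃ φ : X → ℝ, ContMDiff (𝓡 m) 𝓘(ℝ, ℝ) ∞ φ ∧ HasCompactSupport φ ∧
      (∀ y ∈ Metric.eball p 1, 1 / 2 ≤ φ y) ∧
      ∀ y, ∀ v : TangentSpace (𝓡 m) y, |mvfderiv (𝓡 m) φ y v| ≤ ε * ‖v‖ := by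
  have : LocallyCompactSpace X := ChartedSpace.locallyCompactSpace (EuclideanSpace ℝ (Fin m)) X
  -- With slope and approximation error both `c`, the differential is bounded by `4c + c ≤ ε` and
  -- the values on the unit ball are at least `1 - 2c ≥ 1/2`.
  set c : ℝ := min (ε / 8) (1 / 4) with hc
  have hc0 : 0 < c := by positivity
  have hcε : c ≤ ε / 8 := min_le_left _ _
  have hc4 : c ≤ 1 / 4 := min_le_right _ _
  set L : ℝ≥0 := ⟨c, hc0.le⟩ with hL
  have hL0 : L ≠ 0 := fun h ↦ hc0.ne' (congrArg NNReal.toReal h)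
  -- Truncated subtraction supplies the maximum with `0`. Points at infinite distance from `p` get
  -- the value `0`, because `L ≠ 0`.
  let u : X → ℝ := fun y ↦ (1 - L * edist p y).toReal
  have hu : LipschitzWith L u := fun y z ↦ by
    have key : ∀ a b : X, u a ≤ u b + (L * edist a b).toReal ∨ edist a b = ⊤ := by
      intro a b
      refine or_iff_not_imp_right.2 fun hab ↦ ?_
      rw [← ENNReal.toReal_add (by simp) (by finiteness)]
      refine ENNReal.toReal_mono (by finiteness) ?_
      rw [tsub_le_iff_right]
      calc (1 : ℝ≥0∞) ≤ 1 - L * edist p b + L * edist p b := le_tsub_add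
        _ ≤ 1 - L * edist p b + L * (edist p a + edist a b) := by gcongr; exact edist_triangle _ _ _
        _ = _ := by ring
    by_cases hyz : edist y z = ⊤
    · rw [hyz, ENNReal.mul_top (by simpa using hL0)]
      exact le_top
    · have h1 := (key y z).resolve_right hyz
      have h2 := (key z y).resolve_right (by rwa [edist_comm])
      rw [edist_comm z y] at h2
      rw [edist_dist, Real.dist_eq, ← ENNReal.ofReal_toReal (a := L * edist y z) (by finiteness)]
      exact ENNReal.ofReal_le_ofReal (abs_le.2 ⟨by linarith, by linarith⟩)
  -- The function vanishes from distance `1/L` on; the extra `1` makes it vanish off the interior of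
  -- the ball.
  have hK : IsCompact (Metric.closedEBall p ((L⁻¹ + 1 : ℝ≥0) : ℝ≥0∞)) :=
    isCompact_closedEBall_of_interpolation
      (fun x y s r h ↦ exists_edist_le_of_edist_lt_add (𝓡 m) h) p _
  have h0 : ∀ y ∉ interior (Metric.closedEBall p ((L⁻¹ + 1 : ℝ≥0) : ℝ≥0∞)), u y = 0 := by
    intro y hy
    have h1 : ((L⁻¹ : ℝ≥0) : ℝ≥0∞) ≤ edist p y := by
      by_contra! h
      refine hy (interior_maximal ?_ Metric.isOpen_eball
        (show y ∈ Metric.eball p ((L⁻¹ + 1 : ℝ≥0) : ℝ≥0∞) from ?_))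
      · exact Metric.eball_subset_closedEBall
      · rw [Metric.mem_eball']
        exact h.trans (by exact_mod_cast lt_add_one _)
    have h2 : 1 - (L : ℝ≥0∞) * edist p y = 0 := by
      rw [tsub_eq_zero_iff_le]
      calc (1 : ℝ≥0∞) = L * (L⁻¹ : ℝ≥0) := by
            rw [← ENNReal.coe_mul, mul_inv_cancel₀ hL0, ENNReal.coe_one]
        _ ≤ _ := by gcongr
    simp only [u, h2, ENNReal.toReal_zero]
  obtain ⟨φ, h1, h2, h3, h4⟩ := exists_contMDiff_approx_of_lipschitz (m := m) hK hu h0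
    (η := c) hc0
  refine ⟨φ, h1, h2, fun y hy ↦ ?_, fun y v ↦ (h4 y v).trans ?_⟩
  · have h5 : 1 - c ≤ u y := by
      have : (1 : ℝ≥0∞) - L ≤ 1 - L * edist p y := by
        gcongr
        exact mul_le_of_le_one_right' (Metric.mem_eball'.1 hy).le
      have h6 := ENNReal.toReal_mono (by finiteness) this
      have hL1 : (L : ℝ≥0∞) ≤ 1 := by
        rw [ENNReal.coe_le_one_iff, ← NNReal.coe_le_coe]
        exact hc4.trans (by norm_num)
      rw [ENNReal.toReal_sub_of_le hL1 (by simp)] at h6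
      exact h6
    have := (abs_le.1 (h3 y)).1
    linarith
  · gcongr
    change 4 * c + c ≤ ε
    linarith

end Approx

/-! ### Gradient and Riemannian volume -/

section Volume

open MeasureTheory

variable {m : ℕ} {X : Type*} [TopologicalSpace X] [ChartedSpace (EuclideanSpace ℝ (Fin m)) X]
  [RiemannianBundle (fun x : X ↦ TangentSpace (𝓡 m) x)]

theorem inner_grad (φ : X → ℝ) (x : X) (v : TangentSpace (𝓡 m) x) :
    inner ℝ (grad (m := m) φ x) v = mvfderiv (𝓡 m) φ x v := by
  conv_rhs => rw [← (onb x).sum_repr' v, map_sum]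
  rw [grad, sum_inner]
  refine Finset.sum_congr rfl fun a _ ↦ ?_
  rw [real_inner_smul_left, map_smul, smul_eq_mul, mul_comm]

/-- Apply the differential to the gradient itself: `|∇φ|² = dφ(∇φ) ≤ C |∇φ|`. -/
theorem norm_grad_le {φ : X → ℝ} {x : X} {C : ℝ} (hC : 0 ≤ C)
    (hφ : ∀ v : TangentSpace (𝓡 m) x, |mvfderiv (𝓡 m) φ x v| ≤ C * ‖v‖) :
    ‖grad (m := m) φ x‖ ≤ C := by
  have h := (le_abs_self _).trans (hφ (grad (m := m) φ x))
  rw [← inner_grad, real_inner_self_eq_norm_mul_norm] at h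
  by_contra! h'
  exact absurd (le_of_mul_le_mul_right h (hC.trans_lt h')) (not_le.2 h')

variable [IsManifold (𝓡 m) 1 X]

/-- It is the Gram matrix of the coordinate fields, which are independent as images of a basis under
an isomorphism. Hence the volume density is positive. -/
theorem posDef_metricMatrix (x : X) {y : EuclideanSpace ℝ (Fin m)}
    (hy : y ∈ (extChartAt (𝓡 m) x).target) : (metricMatrix (m := m) x y).PosDef := by
  let T := trivializationAt (EuclideanSpace ℝ (Fin m)) (TangentSpace (𝓡 m)) x
  have hx : (extChartAt (𝓡 m) x).symm y ∈ T.baseSet := by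
    simpa [T] using (extChartAt (𝓡 m) x).map_target hy
  have hli : LinearIndependent ℝ (coordVec (m := m) x y) := by
    have h1 : LinearIndependent ℝ fun i : Fin m ↦
        (EuclideanSpace.single i 1 : EuclideanSpace ℝ (Fin m)) := by
      rw [← funext (EuclideanSpace.basisFun_apply (Fin m) ℝ)]
      exact (EuclideanSpace.basisFun (Fin m) ℝ).orthonormal.linearIndependent
    have h2 := h1.map' (T.continuousLinearEquivAt ℝ _ hx).symm.toLinearEquiv.toLinearMap
      (LinearEquiv.ker _)
    have h3 : coordVec (m := m) x y = _ := funext fun i ↦ by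
      rw [coordVec, ← symmL_trivializationAt_eq_mfderiv_extChartAt_symm x hy,
        ← Trivialization.symm_continuousLinearEquivAt_eq _ hx]
    rw [h3]
    exact h2
  exact Matrix.posDef_gram_of_linearIndependent hli

/-- The coordinate fields are continuous sections, and so is their pairing; this makes the volume
density measurable. -/
theorem continuousOn_metricMatrix [IsContinuousRiemannianBundle (EuclideanSpace ℝ (Fin m))
    (fun x : X ↦ TangentSpace (𝓡 m) x)] (x : X) :
    ContinuousOn (metricMatrix (m := m) x) (extChartAt (𝓡 m) x).target := by
  let T := trivializationAt (EuclideanSpace ℝ (Fin m)) (TangentSpace (𝓡 m)) x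
  have h1 : ∀ i, ContinuousOn (fun y ↦ (⟨(extChartAt (𝓡 m) x).symm y, coordVec x y i⟩ :
      TotalSpace (EuclideanSpace ℝ (Fin m)) (fun x : X ↦ TangentSpace (𝓡 m) x)))
      (extChartAt (𝓡 m) x).target := by
    intro i
    have h2 := T.continuousOn_symm.comp ((continuousOn_extChartAt_symm (I := 𝓡 m) x).prodMk
      (continuousOn_const (c := (EuclideanSpace.single i 1 : EuclideanSpace ℝ (Fin m)))))
      fun y hy ↦ ⟨by simpa [T] using (extChartAt (𝓡 m) x).map_target hy, Set.mem_univ _⟩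
    refine h2.congr fun y hy ↦ ?_
    simp only [coordVec, Function.comp_apply]
    rw [← symmL_trivializationAt_eq_mfderiv_extChartAt_symm x hy, Trivialization.symmL_apply]
    simpa using (extChartAt (𝓡 m) x).map_target hy
  refine continuousOn_pi.2 fun i ↦ continuousOn_pi.2 fun j ↦ ?_
  exact (h1 i).inner_bundle (h1 j)

variable [IsContinuousRiemannianBundle (EuclideanSpace ℝ (Fin m)) (fun x : X ↦ TangentSpace (𝓡 m) x)]
  [MeasurableSpace X] [BorelSpace X]

/-- The Riemannian volume of a nonempty open set is positive. -/
theorem riemVolume_pos_of_isOpen {U : Set X} (hU : IsOpen U) (hne : U.Nonempty) :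
    0 < riemVolume m X U := by
  obtain ⟨x, hx⟩ := hne
  refine lt_of_lt_of_le ?_ (Measure.le_iff'.1 (le_iSup (fun x : X ↦ chartVolume (m := m) x) x) U)
  set e := extChartAt (𝓡 m) x with he
  have hto : IsOpen e.target := isOpen_extChartAt_target x
  set d : EuclideanSpace ℝ (Fin m) → ℝ≥0∞ := fun y ↦
    ENNReal.ofReal (Real.sqrt (metricMatrix x y).det) with hd
  have hdm : AEMeasurable d (volume.restrict e.target) := by
    refine ContinuousOn.aemeasurable ?_ hto.measurableSet
    exact ENNReal.continuous_ofReal.comp_continuousOn (Real.continuous_sqrt.comp_continuousOn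
      (continuous_id.matrix_det.comp_continuousOn (continuousOn_metricMatrix x)))
  have hd0 : ∀ᵐ y ∂(volume.restrict e.target), d y ≠ 0 := by
    refine ae_restrict_of_forall_mem hto.measurableSet fun y hy ↦ ?_
    simpa [hd] using (posDef_metricMatrix x hy).det_pos
  have hem : AEMeasurable e.symm ((volume.restrict e.target).withDensity d) :=
    ((continuousOn_extChartAt_symm x).aemeasurable hto.measurableSet).mono_ac
      (withDensity_absolutelyContinuous _ _)
  refine lt_of_lt_of_le ?_ (Measure.le_map_apply hem U)
  rw [pos_iff_ne_zero]
  intro h0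
  -- As the density does not vanish, a null `U` would have a Lebesgue-null coordinate image, but
  -- that image is open and nonempty.
  have h1 := withDensity_absolutelyContinuous' hdm hd0 h0
  rw [Measure.restrict_apply' hto.measurableSet, Set.inter_comm] at h1
  refine ((continuousOn_extChartAt_symm x).isOpen_inter_preimage hto hU).measure_ne_zero volume
    ⟨e x, mem_extChartAt_target x, ?_⟩ h1
  simpa [he] using hx

end Volume

/-! ### The stability argument -/

theorem IsContMDiffRiemannianBundle.isContinuousRiemannianBundle {m : ℕ} {X : Type*}
    [TopologicalSpace X] [ChartedSpace (EuclideanSpace ℝ (Fin m)) X]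
    [RiemannianBundle (fun x : X ↦ TangentSpace (𝓡 m) x)] [IsManifold (𝓡 m) 1 X]
    [h : IsContMDiffRiemannianBundle (𝓡 m) ∞ (EuclideanSpace ℝ (Fin m))
      (fun x : X ↦ TangentSpace (𝓡 m) x)] :
    IsContinuousRiemannianBundle (EuclideanSpace ℝ (Fin m))
      (fun x : X ↦ TangentSpace (𝓡 m) x) :=
  let ⟨g, hg, hgi⟩ := h.exists_contMDiff
  ⟨g, hg.continuous, hgi⟩

theorem theorem1p3 {n : ℕ}
    {M : Type*} [EMetricSpace M] [ChartedSpace (EuclideanSpace ℝ (Fin (n + 1))) M]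
    [IsManifold (𝓡 (n + 1)) ∞ M]
    [RiemannianBundle (fun x : M ↦ TangentSpace (𝓡 (n + 1)) x)]
    [IsContMDiffRiemannianBundle (𝓡 (n + 1)) ∞ (EuclideanSpace ℝ (Fin (n + 1)))
      (fun x : M ↦ TangentSpace (𝓡 (n + 1)) x)]
    [IsRiemannianManifold (𝓡 (n + 1)) M] [CompleteSpace M]
    (f : M → ℝ) (hf : ContMDiff (𝓡 (n + 1)) 𝓘(ℝ, ℝ) ∞ f)
    (k : ℝ) (hk : 0 < k)
    (hRic : ∀ (x : M) (v : TangentSpace (𝓡 (n + 1)) x), k * inner ℝ v v ≤ ricciF f x v v)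
    {S : Type*} [EMetricSpace S] [SecondCountableTopology S] [Nonempty S]
    [MeasurableSpace S] [BorelSpace S]
    [ChartedSpace (EuclideanSpace ℝ (Fin n)) S] [IsManifold (𝓡 n) ∞ S]
    [RiemannianBundle (fun p : S ↦ TangentSpace (𝓡 n) p)]
    [IsContMDiffRiemannianBundle (𝓡 n) ∞ (EuclideanSpace ℝ (Fin n))
      (fun p : S ↦ TangentSpace (𝓡 n) p)]
    [IsRiemannianManifold (𝓡 n) S] [CompleteSpace S]
    (ι : S → M) (hι : IsIsometricImmersion (n := n) ι) :
    ¬ ∃ ν : (p : S) → TangentSpace (𝓡 (n + 1)) (ι p),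
      IsUnitNormal ι ν ∧ IsFMinimal f ι ν ∧ IsLfStable f ι ν ∧ weightedVolume n f ι < ⊤ := by
  rintro ⟨ν, hν, -, hst, hvol⟩
  have := IsContMDiffRiemannianBundle.isContinuousRiemannianBundle (m := n) (X := S)
  have : LocallyCompactSpace S := ChartedSpace.locallyCompactSpace (EuclideanSpace ℝ (Fin n)) S
  obtain ⟨p⟩ := ‹Nonempty S›
  set μ := weightedMeasure n f ι with hμ
  have hμuniv : μ Set.univ ≠ ⊤ := by
    rw [hμ, weightedMeasure, MeasureTheory.withDensity_apply _ .univ,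
      MeasureTheory.Measure.restrict_univ]
    exact hvol.ne
  set U : Set S := Metric.eball p 1
  have hU : μ U ≠ 0 := by
    intro h0
    have hm : Measurable fun p : S ↦ ENNReal.ofReal (Real.exp (-f (ι p))) :=
      (ENNReal.continuous_ofReal.comp (Real.continuous_exp.comp
        (hf.continuous.comp hι.contMDiff.continuous).neg)).measurable
    refine (riemVolume_pos_of_isOpen (m := n) (U := U) Metric.isOpen_eball
      ⟨p, Metric.mem_eball_self one_pos⟩).ne' ?_
    exact MeasureTheory.withDensity_absolutelyContinuous' hm.aemeasurable
      (.of_forall fun p ↦ by simp [Real.exp_pos]) h0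
  have hUtop : μ U ≠ ⊤ := MeasureTheory.measure_ne_top_of_subset (Set.subset_univ _) hμuniv
  -- Stability compares the integrals of the negative and positive parts. Pointwise bounds on these
  -- suffice, so no integrability of the integrand is needed.
  have key : ∀ t : ℝ, 0 < t → t ≤ k / 8 → k / 8 * (μ U).toReal ≤ t * (μ Set.univ).toReal := by
    intro t ht htk
    obtain ⟨φ, hφ, hφc, hφU, hφd⟩ := exists_cutoff_abs_mvfderiv_le (m := n) p (Real.sqrt_pos.2 ht)
    have hgrad : ∀ y, ‖grad (m := n) φ y‖ ^ 2 ≤ t := fun y ↦ by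
      rw [← Real.sq_sqrt ht.le]
      exact pow_le_pow_left₀ (norm_nonneg _) (norm_grad_le (Real.sqrt_nonneg t) (hφd y)) 2
    have hq : ∀ y, k ≤ normSqA ι ν y + ricciF f (ι y) (ν y) (ν y) := fun y ↦ by
      have h1 := hRic (ι y) (ν y)
      rw [real_inner_self_eq_norm_sq, hν.norm_eq_one y] at h1
      have h2 : 0 ≤ normSqA ι ν y :=
        Finset.sum_nonneg fun a _ ↦ Finset.sum_nonneg fun b _ ↦ sq_nonneg _
      linarith
    have h1 : ENNReal.ofReal (k / 8) * μ U ≤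
        ∫⁻ y, ENNReal.ofReal (-stabilityIntegrand f ι ν φ y) ∂μ := by
      rw [← MeasureTheory.setLIntegral_const]
      refine (MeasureTheory.setLIntegral_mono' Metric.isOpen_eball.measurableSet fun y hy ↦
        ENNReal.ofReal_le_ofReal ?_).trans (MeasureTheory.setLIntegral_le_lintegral U _)
      have h2 : (1 / 4 : ℝ) ≤ φ y ^ 2 := by nlinarith [hφU y hy]
      have h3 := mul_le_mul (hq y) h2 (by norm_num) (hk.le.trans (hq y))
      have h4 := hgrad y
      rw [stabilityIntegrand]
      linarith
    have h2 : ∫⁻ y, ENNReal.ofReal (stabilityIntegrand f ι ν φ y) ∂μ ≤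
        ENNReal.ofReal t * μ Set.univ := by
      rw [← MeasureTheory.lintegral_const]
      refine MeasureTheory.lintegral_mono fun y ↦ ENNReal.ofReal_le_ofReal ?_
      have h3 := mul_nonneg (hk.le.trans (hq y)) (sq_nonneg (φ y))
      have h4 := hgrad y
      rw [stabilityIntegrand]
      linarith
    have h3 := ENNReal.toReal_mono (ENNReal.mul_ne_top ENNReal.ofReal_ne_top hμuniv)
      ((h1.trans (hst φ hφ hφc)).trans h2)
    rwa [ENNReal.toReal_mul, ENNReal.toReal_mul, ENNReal.toReal_ofReal (by positivity),
      ENNReal.toReal_ofReal ht.le] at h3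
  have ha : 0 < (μ U).toReal := ENNReal.toReal_pos hU hUtop
  set a := (μ U).toReal
  set b := (μ Set.univ).toReal
  have hb : 0 ≤ b := ENNReal.toReal_nonneg
  -- With `a = μ(U)` and `b = μ(Σ)`, this gives `t b ≤ k a / 16 < k a / 8`, against `key`; `b + 1`
  -- avoids a zero denominator.
  set t := min (k / 8) (k / 16 * a / (b + 1)) with ht
  have h1 := key t (by positivity) (min_le_left _ _)
  have h2 : t * (b + 1) ≤ k / 16 * a := (le_div_iff₀ (by positivity)).1 (min_le_right _ _)
  have h3 : 0 < t := by positivity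
  have h4 : 0 < k * a := by positivity
  linarith
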